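/- Let $p$ be an odd prime, $n\ge 1$, $q=p^n$, and let $\zeta$ be a primitive $p$-th root of unity (in a field of characteristic $0$). Let $\mathrm{Tr}:\mathbb F_q\to\mathbb F_p$, $\mathrm{Tr}(x)=x+x^p+\dots+x^{p^{n-1}}$, be the absolute trace, and for $a\in\mathbb F_q$ let $$\mathcal K_q(a)=\sum_{x\in\mathbb F_q}\zeta^{\mathrm{Tr}(x^{-1}+ax)},\qquad 0^{-1}:=0,$$ be the Kloosterman sum. Then for every $a\in\mathbb F_q$ the product $\prod_{i=1}^{(p-1)/2}\mathcal K_q(i^2a)$ is a rational integer, and if $q\neq 3$, $$\prod_{i=1}^{(p-1)/2}\mathcal K_q(i^2a)\equiv p\left(\frac{\mathrm{Tr}(a)}{p}\right)\pmod{p^2},$$ where $\left(\frac{\cdot}{p}\right)$ is the Legendre symbol. Moreover, for every $q$ (including $q=3$), the polynomial $c_a(x)=\prod_{i=1}^{(p-1)/2}\bigl(x-\mathcal K_q(i^2a)\bigr)$ has integer coefficients and is the characteristic polynomial of $\mathcal K_q(a)$ over $\mathbb Q$, in the sense that $c_a=m_a^{e}$ for some $e\mid\frac{p-1}{2}$,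 where $m_a$ is the minimal polynomial of $\mathcal K_q(a)$ over $\mathbb Q$; its constant term $(-1)^{(p-1)/2}\prod_{i=1}^{(p-1)/2}\mathcal K_q(i^2a)$ is congruent to $0$, $p$ or $-p$ modulo $p^2$. -/

import Mathlib

open Polynomial

noncomputable section

/-- The Kloosterman sum `K_q(a) = ∑_{x ∈ F} ζ ^ Tr(x⁻¹ + a x)` of an element `a` of a finite field `F`
of characteristic `p`, with `0⁻¹ = 0`. Here `Tr : F → 𝔽_p` is the absolute trace and `ζ` is a
`p`-th root of unity in `L`. -/
def kloostermanSum (p : ℕ) {F : Type*} [Field F] [Fintype F] [Algebra (ZMod p) F]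
    {L : Type*} [Field L] (ζ : L) (a : F) : L :=
  ∑ x : F, ζ ^ (Algebra.trace (ZMod p) F (x⁻¹ + a * x)).val

/-- The polynomial `c_a(X) = ∏_{i = 1}^{(p - 1) / 2} (X - K_q(i² a))`. -/
def kloostermanCharpoly (p : ℕ) {F : Type*} [Field F] [Fintype F] [Algebra (ZMod p) F]
    {L : Type*} [Field L] (ζ : L) (a : F) : L[X] :=
  ∏ i ∈ Finset.Icc 1 ((p - 1) / 2),
    (X - C (kloostermanSum p ζ ((i : F) ^ 2 * a)))

end

/-!
Fix `π = ζ - 1` in the ring of integers of `ℚ(ζ)` and write `h = (p - 1) / 2`.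

**Conjugates.** The substitution `x = j y` shows that `ζ ↦ ζ ^ j` sends `K_q(a)` to `K_q(j² a)`
(`ringKloostermanSum_pow`). As `1, …, h` represent the nonzero residues modulo `p` up to sign, the
Galois group permutes the factors of `c_a` (`map_kloostermanCharpoly`), so the coefficients of `c_a`
are rational algebraic integers. All roots of `c_a` are conjugate to `K_q(a)`, hence `c_a` divides
`m_a ^ h` and, being monic, is a power of the irreducible polynomial `m_a`
(`exists_eq_minpoly_pow`).

**The congruence.** Expand `ζ ^ t = (1 + π) ^ t` to second order and sum over `x`, where `t` is the
representative of `Tr(x⁻¹ + a x)` in `[0, p)`. The constant term `q` vanishes modulo `π³` when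
`q ≠ 3`, and the linear term vanishes because `x ↦ -x` changes the sign of the trace. For the
quadratic term, write the trace as a sum of Frobenius powers: the power sums of `F` leave only
`∑ Tr(x⁻¹ + a x)² = -2 Tr(a)` (`sum_trace_inv_add_mul_sq`). Hence `K_q(a) ≡ -π² Tr(a) [mod π³]`
(`sub_one_pow_three_dvd_ringKloostermanSum_add`).

Multiplying over the conjugates gives `π ^ (p - 1) * ∏ (-i²) * Tr(a) ^ h` modulo `π ^ p`. Here
`∏ (-i²) ≡ (p - 1)! ≡ -1`, the power `Tr(a) ^ h` is the Legendre symbol by Euler's criterion, and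
`π ^ (p - 1) ≡ -p [mod π ^ p]` (`sub_one_pow_dvd_prime_add`), so the product is
`p (Tr(a) / p)` modulo `π ^ p`. A rational integer divisible by `π ^ p` is divisible by `p²`
(`prime_sq_dvd_of_sub_one_pow_dvd`). For `q = 3` only `π ∣ K_q(a)` is needed: it gives `3 ∣ m`, and
every multiple of `3` is `0` or `± 3` modulo `9`.
-/

/-! ### Power sums and traces over a finite field -/

section FiniteField

variable (p : ℕ) [Fact p.Prime] {F : Type*} [Field F] [Fintype F] [Algebra (ZMod p) F]

theorem card_eq_prime_pow_finrank :
    Fintype.card F = p ^ Module.finrank (ZMod p) F := by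
  rw [Module.card_eq_pow_finrank (K := ZMod p), ZMod.card]

/-- The exponent `p ^ i + p ^ j` is less than `q - 1`; for odd `p`, only `q = 3`
is an exception. -/
theorem sum_pow_add_pow_eq_zero (hp : p ≠ 2) (hq : Fintype.card F ≠ 3) {i j : ℕ}
    (hi : i < Module.finrank (ZMod p) F) (hj : j < Module.finrank (ZMod p) F) :
    ∑ x : F, x ^ (p ^ i + p ^ j) = 0 := by
  apply FiniteField.sum_pow_lt_card_sub_one
  have hc := card_eq_prime_pow_finrank p (F := F)
  have hpp : p.Prime := Fact.out
  have h3 : 3 ≤ p := by have := hpp.two_le; omega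
  obtain ⟨m, hm⟩ : ∃ m, Module.finrank (ZMod p) F = m + 1 := ⟨_, (Nat.succ_pred (by omega)).symm⟩
  rw [hm] at hi hj hc
  have h1 : p ^ i ≤ p ^ m := Nat.pow_le_pow_right hpp.pos (by omega)
  have h2 : p ^ j ≤ p ^ m := Nat.pow_le_pow_right hpp.pos (by omega)
  have h4 : 1 ≤ p ^ m := Nat.one_le_pow _ _ hpp.pos
  rw [hc, pow_succ] at hq ⊢
  rcases h3.eq_or_lt with rfl | h3
  · omega
  · nlinarith [Nat.sub_add_cancel (show 1 ≤ p ^ m * p by nlinarith)]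

theorem sum_comp_inv {M : Type*} [AddCommMonoid M] (f : F → M) :
    ∑ x : F, f x⁻¹ = ∑ x : F, f x :=
  Equiv.sum_comp (Function.Involutive.toPerm (·⁻¹) inv_involutive) f

theorem sum_inv_pow_mul_pow (i j : ℕ)
    (hi : i < Module.finrank (ZMod p) F) (hj : j < Module.finrank (ZMod p) F) :
    ∑ x : F, x⁻¹ ^ p ^ i * x ^ p ^ j = if i = j then -1 else 0 := by
  classical
  have hpp : p.Prime := Fact.out
  have hc := card_eq_prime_pow_finrank p (F := F)
  have off_diagonal : ∀ i j : ℕ, i < j → j < Module.finrank (ZMod p) F →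
      ∑ x : F, x⁻¹ ^ p ^ i * x ^ p ^ j = 0 := by
    intro i j hij hj
    have hlt : p ^ i < p ^ j := Nat.pow_lt_pow_right hpp.one_lt hij
    have hjn : p ^ j < Fintype.card F := hc ▸ Nat.pow_lt_pow_right hpp.one_lt hj
    have hipos : 0 < p ^ i := Nat.pow_pos hpp.pos
    rw [← FiniteField.sum_pow_lt_card_sub_one F (p ^ j - p ^ i) (by omega)]
    refine Finset.sum_congr rfl fun x _ => ?_
    rcases eq_or_ne x 0 with rfl | hx
    · rw [inv_zero, zero_pow hipos.ne', zero_mul, zero_pow (by omega)]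
    · rw [inv_pow, pow_sub₀ x hx hlt.le, mul_comm]
  rcases lt_trichotomy i j with h | rfl | h
  · rw [off_diagonal i j h hj, if_neg h.ne]
  · rw [if_pos rfl]
    have hterm : ∀ x : F, x⁻¹ ^ p ^ i * x ^ p ^ i = 1 - if x = 0 then 1 else 0 := by
      intro x
      have hne : p ^ i ≠ 0 := (Nat.pow_pos hpp.pos).ne'
      rcases eq_or_ne x 0 with rfl | hx
      · rw [if_pos rfl, zero_pow hne, mul_zero, sub_self]
      · rw [← mul_pow, inv_mul_cancel₀ hx]; simp [hx]
    simp only [hterm]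
    simp
  · rw [if_neg h.ne', ← off_diagonal j i h hi, ← sum_comp_inv]
    simp [mul_comm]

theorem algebraMap_trace_eq_sum_pow_prime (x : F) :
    algebraMap (ZMod p) F (Algebra.trace (ZMod p) F x) =
      ∑ i ∈ Finset.range (Module.finrank (ZMod p) F), x ^ p ^ i := by
  rw [FiniteField.algebraMap_trace_eq_sum_pow, Nat.card_zmod]

theorem sum_trace_mul_sq (hp : p ≠ 2) (hq : Fintype.card F ≠ 3) (b : F) :
    ∑ x : F, Algebra.trace (ZMod p) F (b * x) ^ 2 = 0 := by
  apply (algebraMap (ZMod p) F).injective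
  simp only [sq, map_sum, map_mul, map_zero, algebraMap_trace_eq_sum_pow_prime,
    Finset.sum_mul_sum]
  rw [Finset.sum_comm]
  refine Finset.sum_eq_zero fun i hi => ?_
  rw [Finset.sum_comm]
  refine Finset.sum_eq_zero fun j hj => ?_
  have h : ∀ x : F, (b * x) ^ p ^ i * (b * x) ^ p ^ j =
      b ^ (p ^ i + p ^ j) * x ^ (p ^ i + p ^ j) := fun x => by rw [← pow_add, mul_pow]
  simp only [h, ← Finset.mul_sum]
  rw [sum_pow_add_pow_eq_zero p hp hq (Finset.mem_range.1 hi) (Finset.mem_range.1 hj), mul_zero]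

theorem sum_trace_inv_mul_trace (b : F) :
    ∑ x : F, Algebra.trace (ZMod p) F x⁻¹ * Algebra.trace (ZMod p) F (b * x) =
      -Algebra.trace (ZMod p) F b := by
  apply (algebraMap (ZMod p) F).injective
  simp only [map_sum, map_mul, map_neg, algebraMap_trace_eq_sum_pow_prime, Finset.sum_mul_sum]
  rw [Finset.sum_comm, ← Finset.sum_neg_distrib]
  refine Finset.sum_congr rfl fun i hi => ?_
  rw [Finset.sum_comm]
  have h : ∀ j ∈ Finset.range (Module.finrank (ZMod p) F),
      ∑ x : F, x⁻¹ ^ p ^ i * (b * x) ^ p ^ j = b ^ p ^ j * if i = j then -1 else 0 := by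
    intro j hj
    rw [← sum_inv_pow_mul_pow p i j (Finset.mem_range.1 hi) (Finset.mem_range.1 hj),
      Finset.mul_sum]
    exact Finset.sum_congr rfl fun x _ => by rw [mul_pow]; ring
  rw [Finset.sum_congr rfl h]
  simp [Finset.mem_range.1 hi]

theorem sum_trace_inv_add_mul (hp : p ≠ 2) (b : F) :
    ∑ x : F, Algebra.trace (ZMod p) F (x⁻¹ + b * x) = 0 := by
  have h := Equiv.sum_comp (Equiv.neg F) fun x => Algebra.trace (ZMod p) F (x⁻¹ + b * x)
  simp only [Equiv.neg_apply, inv_neg, mul_neg, ← neg_add, map_neg, Finset.sum_neg_distrib] at h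
  refine ((ZMod.neg_eq_self_iff _).1 h).resolve_right fun h2 => hp ?_
  exact ((Nat.prime_dvd_prime_iff_eq Nat.prime_two Fact.out).1 ⟨_, h2.symm⟩).symm

theorem sum_trace_inv_add_mul_sq (hp : p ≠ 2) (hq : Fintype.card F ≠ 3) (b : F) :
    ∑ x : F, Algebra.trace (ZMod p) F (x⁻¹ + b * x) ^ 2 = -2 * Algebra.trace (ZMod p) F b := by
  have h : ∀ x : F, Algebra.trace (ZMod p) F (x⁻¹ + b * x) ^ 2 =
      Algebra.trace (ZMod p) F (1 * x⁻¹) ^ 2 + Algebra.trace (ZMod p) F (b * x) ^ 2 +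
        2 * (Algebra.trace (ZMod p) F x⁻¹ * Algebra.trace (ZMod p) F (b * x)) := fun x => by
    rw [map_add, one_mul]; ring
  simp only [h, Finset.sum_add_distrib, ← Finset.mul_sum]
  rw [sum_comp_inv fun x : F => Algebra.trace (ZMod p) F (1 * x) ^ 2, sum_trace_mul_sq p hp hq,
    sum_trace_mul_sq p hp hq, sum_trace_inv_mul_trace]
  ring

/-- Stated over the natural numbers, for the representatives of the traces in `[0, p)`. -/
theorem dvd_sum_val_trace (hp : p ≠ 2) (b : F) :
    p ∣ ∑ x : F, (Algebra.trace (ZMod p) F (x⁻¹ + b * x)).val := by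
  rw [← ZMod.natCast_eq_zero_iff, Nat.cast_sum]
  simp only [ZMod.natCast_zmod_val]
  exact sum_trace_inv_add_mul p hp b

theorem dvd_sum_choose_val_trace_add (hp : p ≠ 2) (hq : Fintype.card F ≠ 3) (b : F) :
    p ∣ ∑ x : F, (Algebra.trace (ZMod p) F (x⁻¹ + b * x)).val.choose 2 +
      (Algebra.trace (ZMod p) F b).val := by
  have hpp : p.Prime := Fact.out
  have h2 : p.Coprime 2 := (Nat.coprime_primes hpp Nat.prime_two).2 hp
  apply h2.dvd_of_dvd_mul_left
  rw [← ZMod.natCast_eq_zero_iff]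
  have hch : ∀ t : ZMod p, 2 * (t.val.choose 2 : ZMod p) = t ^ 2 - t := by
    intro t
    have h : t.val * (t.val - 1) = 2 * t.val.choose 2 := by
      rw [Nat.choose_two_right, Nat.mul_div_cancel' (Nat.even_mul_pred_self _).two_dvd]
    have h' := congrArg (Nat.cast : ℕ → ZMod p) (congrArg (· + t.val) h)
    have h'' : t.val * (t.val - 1) + t.val = t.val ^ 2 := by cases t.val <;> simp; ring
    rw [h''] at h'
    push_cast [ZMod.natCast_zmod_val] at h'
    rw [h']; ring
  push_cast [ZMod.natCast_zmod_val]
  rw [mul_add, Finset.mul_sum]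
  simp only [hch, Finset.sum_sub_distrib]
  rw [sum_trace_inv_add_mul p hp, sum_trace_inv_add_mul_sq p hp hq]
  ring

end FiniteField

/-! ### Congruences modulo powers of `ζ - 1` -/

section Congruences

theorem dvd_prod_sub_prod {R ι : Type*} [CommRing R] {d : R} {s : Finset ι} {f g : ι → R}
    (h : ∀ i ∈ s, d ∣ f i - g i) : d ∣ ∏ i ∈ s, f i - ∏ i ∈ s, g i := by
  simp only [← Ideal.mem_span_singleton, ← Ideal.Quotient.eq, map_prod] at h ⊢
  exact Finset.prod_congr rfl h

/-- The binomial expansion of `z ^ t = (1 + (z - 1)) ^ t` to second order. -/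
theorem sub_one_pow_three_dvd {R : Type*} [CommRing R] (z : R) (t : ℕ) :
    (z - 1) ^ 3 ∣ z ^ t - (1 + t * (z - 1) + t.choose 2 * (z - 1) ^ 2) := by
  induction t with
  | zero => simp
  | succ t ih =>
    obtain ⟨r, hr⟩ := ih
    refine ⟨z * r + t.choose 2, ?_⟩
    rw [Nat.choose_succ_succ', Nat.choose_one_right, pow_succ, eq_add_of_sub_eq hr]
    push_cast
    ring

variable {p : ℕ} [Fact p.Prime]

/-- The factors `i` and `p - i` of `(p - 1)!` multiply to `-i²`, so this is Wilson's theorem. -/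
theorem prod_neg_sq_half (hp : p ≠ 2) :
    ∏ i ∈ Finset.Icc 1 ((p - 1) / 2), (-((i : ZMod p) ^ 2)) = -1 := by
  have hodd : p % 2 = 1 := (Fact.out : p.Prime).eq_two_or_odd.resolve_left hp
  rw [← ZMod.prod_Ico_one_prime p,
    ← Finset.prod_Ico_consecutive _ (show 1 ≤ (p - 1) / 2 + 1 by omega) (by omega)]
  have h := Finset.prod_Ico_reflect (fun i : ℕ => (i : ZMod p)) 1
    (show (p - 1) / 2 + 1 ≤ p + 1 by omega)
  rw [show p + 1 - ((p - 1) / 2 + 1) = (p - 1) / 2 + 1 by omega, Nat.add_sub_cancel] at h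
  rw [← h, ← Finset.prod_mul_distrib]
  refine Finset.prod_congr (by ext; simp) fun i hi => ?_
  have := Finset.mem_Icc.1 hi
  rw [Nat.cast_sub (by omega), ZMod.natCast_self]
  ring

variable {R : Type*} [CommRing R] [IsDomain R] {z : R}

/-- The congruence `p ≡ -π ^ (p - 1) [mod π ^ p]` for `π = z - 1`: in `p = ∏ (1 - z ^ k)` each
factor is `-π` times a geometric sum that is `k` modulo `π`, and `(p - 1)! ≡ -1`. -/
theorem sub_one_pow_dvd_prime_add (hp : p ≠ 2) (hz : IsPrimitiveRoot z p) :
    (z - 1) ^ p ∣ (p : R) + (z - 1) ^ (p - 1) := by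
  have hpp : p.Prime := Fact.out
  obtain ⟨n, rfl⟩ : ∃ n, p = n + 1 := ⟨p - 1, (Nat.sub_add_cancel hpp.one_le).symm⟩
  have heven : Even n := by
    have := hpp.eq_two_or_odd.resolve_left hp
    exact Nat.even_iff.2 (by omega)
  have hfac : ((n + 1 : ℕ) : R) =
      (z - 1) ^ n * ∏ k ∈ Finset.range n, ∑ i ∈ Finset.range (k + 1), z ^ i := by
    have h1 : ∀ k ∈ Finset.range n,
        1 - z ^ (k + 1) = -((z - 1) * ∑ i ∈ Finset.range (k + 1), z ^ i) := fun k _ => by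
      rw [mul_geom_sum, neg_sub]
    push_cast
    rw [← hz.prod_one_sub_pow_eq_order, Finset.prod_congr rfl h1, Finset.prod_neg,
      Finset.prod_mul_distrib]
    simp [heven.neg_one_pow]
  have hdvd : z - 1 ∣ ((n + 1 : ℕ) : R) := by
    rw [hfac]
    exact Dvd.dvd.mul_right (dvd_pow_self _ (by have := hpp.two_le; omega)) _
  have hcong : z - 1 ∣ ∏ k ∈ Finset.range n, ∑ i ∈ Finset.range (k + 1), z ^ i -
      ∏ k ∈ Finset.range n, ((k + 1 : ℕ) : R) := by
    refine dvd_prod_sub_prod fun k _ => ?_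
    have : ∑ i ∈ Finset.range (k + 1), z ^ i - ((k + 1 : ℕ) : R) =
        ∑ i ∈ Finset.range (k + 1), (z ^ i - 1 ^ i) := by simp
    rw [this]
    exact Finset.dvd_sum fun i _ => sub_dvd_pow_sub_pow _ _ _
  rw [← Nat.cast_prod, Finset.prod_range_add_one_eq_factorial] at hcong
  have hwilson : n + 1 ∣ n.factorial + 1 := by
    rw [← ZMod.natCast_eq_zero_iff, Nat.cast_add, Nat.cast_one]
    have := ZMod.wilsons_lemma (n + 1)
    rw [Nat.add_sub_cancel] at this
    rw [this, neg_add_cancel]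
  have hw : z - 1 ∣ (n.factorial : R) + 1 := by
    exact_mod_cast hdvd.trans (Nat.cast_dvd_cast (α := R) hwilson)
  have := hcong.add hw
  rw [Nat.add_sub_cancel, hfac, pow_succ, ← mul_add_one]
  apply mul_dvd_mul_left
  convert this using 1
  ring

theorem sub_one_pow_dvd_prime (hp : p ≠ 2) (hz : IsPrimitiveRoot z p) :
    (z - 1) ^ (p - 1) ∣ (p : R) := by
  refine (dvd_add_left (dvd_refl _)).1 (dvd_trans (pow_dvd_pow _ (Nat.sub_le _ _)) ?_)
  exact sub_one_pow_dvd_prime_add hp hz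

theorem sub_one_sq_dvd_prime (hp : p ≠ 2) (hz : IsPrimitiveRoot z p) :
    (z - 1) ^ 2 ∣ (p : R) :=
  (pow_dvd_pow _ (by have := (Fact.out : p.Prime).two_le; omega)).trans
    (sub_one_pow_dvd_prime hp hz)

theorem sub_one_dvd_prime (hp : p ≠ 2) (hz : IsPrimitiveRoot z p) : z - 1 ∣ (p : R) :=
  (dvd_pow_self _ two_ne_zero).trans (sub_one_sq_dvd_prime hp hz)

theorem prime_dvd_of_sub_one_dvd (hp : p ≠ 2) (hz : IsPrimitiveRoot z p) (hu : ¬IsUnit (z - 1))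
    {m : ℤ} (h : z - 1 ∣ (m : R)) : (p : ℤ) ∣ m := by
  by_contra hm
  have hc : IsCoprime (p : ℤ) m :=
    ((Nat.prime_iff_prime_int.1 Fact.out).coprime_iff_not_dvd).2 hm
  have hc' := hc.map (Int.castRingHom R)
  simp only [eq_intCast, Int.cast_natCast] at hc'
  exact hu (hc'.isUnit_of_dvd' (sub_one_dvd_prime hp hz) h)

/-- The integer is `p * m` with `p` equal to `-π ^ (p - 1)` up to a factor `1 + O(π)`, so one factor
`π` is left to divide `m`. -/
theorem prime_sq_dvd_of_sub_one_pow_dvd [CharZero R] (hp : p ≠ 2) (hz : IsPrimitiveRoot z p)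
    (hu : ¬IsUnit (z - 1)) {m : ℤ} (h : (z - 1) ^ p ∣ (m : R)) : (p : ℤ) ^ 2 ∣ m := by
  have hpp : p.Prime := Fact.out
  obtain ⟨m, rfl⟩ := prime_dvd_of_sub_one_dvd hp hz hu ((dvd_pow_self _ hpp.ne_zero).trans h)
  rw [sq]
  refine mul_dvd_mul_left _ (prime_dvd_of_sub_one_dvd hp hz hu ?_)
  have h1 := (sub_one_pow_dvd_prime_add hp hz).mul_right (m : R)
  push_cast at h
  rw [add_mul, dvd_add_right h] at h1
  have hz0 : z - 1 ≠ 0 := sub_ne_zero.2 (hz.ne_one hpp.one_lt)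
  rw [← Nat.sub_add_cancel hpp.one_le, pow_succ, Nat.add_sub_cancel] at h1
  exact (mul_dvd_mul_iff_left (pow_ne_zero _ hz0)).1 h1

end Congruences

/-! ### Kloosterman sums modulo `(ζ - 1)³` -/

/-- The Kloosterman sum of `a` with values in an arbitrary commutative ring, such as a ring of
integers; for a field it is `kloostermanSum`. -/
noncomputable def ringKloostermanSum (p : ℕ) {F : Type*} [Field F] [Fintype F] [Algebra (ZMod p) F]
    {R : Type*} [CommRing R] (z : R) (a : F) : R :=
  ∑ x : F, z ^ (Algebra.trace (ZMod p) F (x⁻¹ + a * x)).val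

section Ring

variable {p : ℕ} [Fact p.Prime] {F : Type*} [Field F] [Fintype F] [Algebra (ZMod p) F]
  {R : Type*} [CommRing R]

theorem map_ringKloostermanSum {S : Type*} [CommRing S] (f : R →+* S) (z : R) (a : F) :
    f (ringKloostermanSum p z a) = ringKloostermanSum p (f z) a := by
  simp [ringKloostermanSum]

variable [IsDomain R] {z : R}

theorem sub_one_dvd_ringKloostermanSum (hp : p ≠ 2) (hz : IsPrimitiveRoot z p) (b : F) :
    z - 1 ∣ ringKloostermanSum p z b := by
  have h : z - 1 ∣ ringKloostermanSum p z b - (Fintype.card F : R) := by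
    have : ringKloostermanSum p z b - (Fintype.card F : R) = ∑ x : F,
        (z ^ (Algebra.trace (ZMod p) F (x⁻¹ + b * x)).val - 1) := by
      simp [ringKloostermanSum, Finset.sum_sub_distrib]
    rw [this]
    exact Finset.dvd_sum fun x _ => sub_one_dvd_pow_sub_one _ _
  refine (dvd_sub_left ?_).1 h
  rw [card_eq_prime_pow_finrank p, Nat.cast_pow]
  exact dvd_pow (sub_one_dvd_prime hp hz) Module.finrank_pos.ne'

/-- For `q = 3` this fails: there `q` is divisible by `(ζ - 1)²` only. -/
theorem sub_one_pow_three_dvd_card (hp : p ≠ 2) (hz : IsPrimitiveRoot z p)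
    (hq : Fintype.card F ≠ 3) : (z - 1) ^ 3 ∣ (Fintype.card F : R) := by
  have hpp : p.Prime := Fact.out
  have hpos : 0 < Module.finrank (ZMod p) F := Module.finrank_pos
  rw [card_eq_prime_pow_finrank p] at hq ⊢
  rw [Nat.cast_pow]
  by_cases hp3 : p = 3
  · have hn : 2 ≤ Module.finrank (ZMod p) F := by
      by_contra hn
      rw [show Module.finrank (ZMod p) F = 1 by omega, pow_one] at hq
      exact hq hp3
    refine dvd_trans ?_ (pow_dvd_pow _ hn)
    exact dvd_trans (by rw [← pow_mul]; exact pow_dvd_pow _ (by norm_num))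
      (pow_dvd_pow_of_dvd (sub_one_sq_dvd_prime hp hz) 2)
  · refine dvd_trans ?_ (dvd_pow_self _ hpos.ne')
    exact (pow_dvd_pow _ (by have := hpp.two_le; have := hpp.eq_two_or_odd; omega)).trans
      (sub_one_pow_dvd_prime hp hz)

theorem sub_one_pow_three_dvd_of_dvd (hp : p ≠ 2) (hz : IsPrimitiveRoot z p) {m : ℕ} (hm : p ∣ m) :
    (z - 1) ^ 3 ∣ (z - 1) * (m : R) := by
  rw [pow_succ']
  exact mul_dvd_mul_left _ ((sub_one_sq_dvd_prime hp hz).trans (Nat.cast_dvd_cast hm))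

/-- The congruence `K_q(b) ≡ -π² Tr(b) [mod π³]` for `π = z - 1`. -/
theorem sub_one_pow_three_dvd_ringKloostermanSum_add (hp : p ≠ 2) (hz : IsPrimitiveRoot z p)
    (hq : Fintype.card F ≠ 3) (b : F) :
    (z - 1) ^ 3 ∣ ringKloostermanSum p z b +
      (z - 1) ^ 2 * ((Algebra.trace (ZMod p) F b).val : R) := by
  set t : F → ℕ := fun x => (Algebra.trace (ZMod p) F (x⁻¹ + b * x)).val with ht
  have h1 : (z - 1) ^ 3 ∣
      ∑ x, (z ^ t x - (1 + t x * (z - 1) + (t x).choose 2 * (z - 1) ^ 2)) :=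
    Finset.dvd_sum fun x _ => sub_one_pow_three_dvd z (t x)
  have h2 := sub_one_pow_three_dvd_card hp hz hq
  have h3 := sub_one_pow_three_dvd_of_dvd hp hz (dvd_sum_val_trace p hp b)
  have h4 := (sub_one_pow_three_dvd_of_dvd hp hz (dvd_sum_choose_val_trace_add p hp hq b)).mul_left
    (z - 1)
  convert ((h1.add h2).add h3).add h4 using 1
  simp only [Finset.sum_sub_distrib, Finset.sum_add_distrib, ← Finset.sum_mul, ringKloostermanSum]
  push_cast
  simp only [ht, Finset.sum_const, Finset.card_univ, nsmul_one]
  ring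

/-! ### The product of the conjugates -/

theorem sub_one_pow_three_dvd_ringKloostermanSum_sq_mul_add (hp : p ≠ 2) (hz : IsPrimitiveRoot z p)
    (hq : Fintype.card F ≠ 3) (a : F) (i : ℕ) :
    (z - 1) ^ 3 ∣ ringKloostermanSum p z ((i : F) ^ 2 * a) +
      (z - 1) ^ 2 * ((i ^ 2 * (Algebra.trace (ZMod p) F a).val : ℕ) : R) := by
  have h1 := sub_one_pow_three_dvd_ringKloostermanSum_add hp hz hq ((i : F) ^ 2 * a)
  have htr : Algebra.trace (ZMod p) F ((i : F) ^ 2 * a) =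
      (i : ZMod p) ^ 2 * Algebra.trace (ZMod p) F a := by
    rw [← smul_eq_mul ((i : ZMod p) ^ 2), ← map_smul, Algebra.smul_def]
    simp
  have hdvd : (p : ℤ) ∣ ((i ^ 2 * (Algebra.trace (ZMod p) F a).val : ℕ) : ℤ) -
      ((Algebra.trace (ZMod p) F ((i : F) ^ 2 * a)).val : ℤ) := by
    rw [← ZMod.intCast_zmod_eq_zero_iff_dvd]
    push_cast [ZMod.natCast_zmod_val]
    rw [htr, sub_self]
  have h2 := (sub_one_dvd_prime hp hz).trans
    (by simpa only [eq_intCast, Int.cast_sub, Int.cast_natCast] using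
      map_dvd (Int.castRingHom R) hdvd)
  have h3 := mul_dvd_mul_left ((z - 1) ^ 2) h2
  rw [← pow_succ] at h3
  convert h1.add h3 using 1
  push_cast
  ring

/-- The product of the conjugates is `p (Tr(a) / p)` modulo `π ^ p`, where `π = z - 1`. -/
theorem sub_one_pow_dvd_prod_sub_legendreSym (hp : p ≠ 2) (hz : IsPrimitiveRoot z p)
    (hq : Fintype.card F ≠ 3) (a : F) :
    (z - 1) ^ p ∣ ∏ i ∈ Finset.Icc 1 ((p - 1) / 2), ringKloostermanSum p z ((i : F) ^ 2 * a) -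
      p * ((legendreSym p ((Algebra.trace (ZMod p) F a).val : ℤ) : ℤ) : R) := by
  have hpp : p.Prime := Fact.out
  have hodd : p % 2 = 1 := hpp.eq_two_or_odd.resolve_left hp
  have hz0 : z - 1 ≠ 0 := sub_ne_zero.2 (hz.ne_one hpp.one_lt)
  set t := (Algebra.trace (ZMod p) F a).val with ht
  set ℓ := legendreSym p (t : ℤ) with hl
  have hquot : ∀ i : ℕ, ∃ r : R, ringKloostermanSum p z ((i : F) ^ 2 * a) = (z - 1) ^ 2 * r ∧
      z - 1 ∣ r - ((-(i ^ 2 * t : ℤ) : ℤ) : R) := by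
    intro i
    obtain ⟨s, hs⟩ := sub_one_pow_three_dvd_ringKloostermanSum_sq_mul_add hp hz hq a i
    refine ⟨(z - 1) * s - (i ^ 2 * t : ℕ), ?_, s, ?_⟩
    · rw [eq_sub_of_add_eq hs]; ring
    · push_cast; ring
  choose r hr hrdvd using hquot
  have hprod : z - 1 ∣ ∏ i ∈ Finset.Icc 1 ((p - 1) / 2), r i -
      ((∏ i ∈ Finset.Icc 1 ((p - 1) / 2), (-(i ^ 2 * t : ℤ)) : ℤ) : R) := by
    rw [Int.cast_prod]
    exact dvd_prod_sub_prod fun i _ => hrdvd i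
  -- Wilson's theorem and Euler's criterion
  have hEuler : (p : ℤ) ∣ ∏ i ∈ Finset.Icc 1 ((p - 1) / 2), (-(i ^ 2 * t : ℤ)) + ℓ := by
    rw [← ZMod.intCast_zmod_eq_zero_iff_dvd]
    push_cast
    simp only [← neg_mul]
    rw [Finset.prod_mul_distrib, prod_neg_sq_half hp, hl, legendreSym.eq_pow, Finset.prod_const,
      Nat.card_Icc, Nat.add_sub_cancel, show (p - 1) / 2 = p / 2 by omega]
    push_cast
    ring
  have hEuler' : z - 1 ∣ ((∏ i ∈ Finset.Icc 1 ((p - 1) / 2), (-(i ^ 2 * t : ℤ)) + ℓ : ℤ) : R) :=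
    (sub_one_dvd_prime hp hz).trans (by
      simpa only [eq_intCast, Int.cast_natCast] using map_dvd (Int.castRingHom R) hEuler)
  have hsum := mul_dvd_mul_left ((z - 1) ^ (p - 1)) (hprod.add hEuler')
  rw [← pow_succ, Nat.sub_add_cancel hpp.one_le] at hsum
  have hp' := (sub_one_pow_dvd_prime_add hp hz).mul_right (ℓ : R)
  rw [Finset.prod_congr rfl fun i _ => hr i, Finset.prod_mul_distrib, Finset.prod_const,
    Nat.card_Icc, Nat.add_sub_cancel, ← pow_mul, show 2 * ((p - 1) / 2) = p - 1 by omega]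
  convert hsum.sub hp' using 1
  push_cast
  ring

end Ring

/-! ### Galois conjugates and the characteristic polynomial -/

section Charpoly

variable {p : ℕ} {F : Type*} [Field F] [Fintype F] [Algebra (ZMod p) F]
  {K : Type*} [Field K] {ζ : K}

theorem monic_kloostermanCharpoly (a : F) : (kloostermanCharpoly p ζ a).Monic :=
  monic_prod_of_monic _ _ fun _ _ => monic_X_sub_C _

theorem natDegree_kloostermanCharpoly (a : F) :
    (kloostermanCharpoly p ζ a).natDegree = (p - 1) / 2 := by
  rw [kloostermanCharpoly, natDegree_prod_of_monic _ _ fun _ _ => monic_X_sub_C _]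
  simp

theorem coeff_zero_kloostermanCharpoly (a : F) :
    (kloostermanCharpoly p ζ a).coeff 0 = (-1) ^ ((p - 1) / 2) *
      ∏ i ∈ Finset.Icc 1 ((p - 1) / 2), kloostermanSum p ζ ((i : F) ^ 2 * a) := by
  simp [kloostermanCharpoly, coeff_zero_prod, Finset.prod_neg]

end Charpoly

section Conjugates

variable {p : ℕ} [Fact p.Prime] {F : Type*} [Field F] [Fintype F] [Algebra (ZMod p) F]

/-- Substitute `x = j y` in the sum. -/
theorem ringKloostermanSum_pow {R : Type*} [CommRing R] {z : R} (hz : z ^ p = 1) {j : ℕ}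
    (hj : ¬p ∣ j) (a : F) :
    ringKloostermanSum p (z ^ j) a = ringKloostermanSum p z ((j : F) ^ 2 * a) := by
  have hj0 : (j : F) ≠ 0 := by
    rw [← map_natCast (algebraMap (ZMod p) F), _root_.map_ne_zero, Ne, ZMod.natCast_eq_zero_iff]
    exact hj
  unfold ringKloostermanSum
  rw [← Equiv.sum_comp (Equiv.mulLeft₀ (j : F) hj0)]
  refine Finset.sum_congr rfl fun y _ => ?_
  have htr : Algebra.trace (ZMod p) F (y⁻¹ + (j : F) ^ 2 * a * y) =
      ((j * (Algebra.trace (ZMod p) F ((j * y)⁻¹ + a * (j * y))).val : ℕ) : ZMod p) := by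
    push_cast [ZMod.natCast_zmod_val]
    rw [← smul_eq_mul (j : ZMod p), ← map_smul, Algebra.smul_def, map_natCast]
    congr 1
    rw [mul_inv, mul_add, mul_inv_cancel_left₀ hj0]
    ring
  rw [htr, ZMod.val_natCast, ← pow_eq_pow_mod _ hz, pow_mul]
  rfl

/-- The numbers `1, …, (p - 1) / 2` represent the nonzero residues modulo `p` up to sign, and
multiplication by `j` permutes these classes. -/
theorem prod_half_mul {F : Type*} [Field F] [Algebra (ZMod p) F] {M : Type*} [CommMonoid M]
    (hp : p ≠ 2) (f : F → M) {j : ℕ} (hj : ¬p ∣ j) :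
    ∏ i ∈ Finset.Icc 1 ((p - 1) / 2), f (((j * i : ℕ) : F) ^ 2) =
      ∏ i ∈ Finset.Icc 1 ((p - 1) / 2), f ((i : F) ^ 2) := by
  have hodd : p % 2 = 1 := (Fact.out : p.Prime).eq_two_or_odd.resolve_left hp
  have hI : Finset.Icc 1 ((p - 1) / 2) = Finset.Ico 1 (p / 2).succ := by
    ext; simp only [Finset.mem_Icc, Finset.mem_Ico]; omega
  have hperm := ZMod.Ico_map_valMinAbs_natAbs_eq_Ico_map_id p (j : ZMod p)
    (by rwa [Ne, ZMod.natCast_eq_zero_iff])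
  have hsq : ∀ m : ℕ, (((m : ZMod p).valMinAbs.natAbs : F)) ^ 2 = (m : F) ^ 2 := by
    intro m
    have h : (((m : ZMod p).valMinAbs.natAbs : ZMod p)) ^ 2 = (m : ZMod p) ^ 2 := by
      have h1 : (((m : ZMod p).valMinAbs.natAbs : ℤ)) ^ 2 = (m : ZMod p).valMinAbs ^ 2 :=
        Int.natAbs_sq _
      have h2 := congrArg (Int.cast : ℤ → ZMod p) h1
      push_cast [ZMod.coe_valMinAbs] at h2
      simpa using h2
    simpa using congrArg (algebraMap (ZMod p) F) h
  have h := congrArg (fun s => (s.map fun m : ℕ => f ((m : F) ^ 2)).prod) hperm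
  simp only [Multiset.map_map, Function.comp_def, ← Nat.cast_mul, hsq] at h
  rw [hI]
  exact h

variable {K : Type*} [Field K] {ζ : K}

theorem map_kloostermanCharpoly (hp : p ≠ 2) (hζ : ζ ^ p = 1) (f : K →+* K) {j : ℕ}
    (hj : ¬p ∣ j) (hf : f ζ = ζ ^ j) (a : F) :
    (kloostermanCharpoly p ζ a).map f = kloostermanCharpoly p ζ a := by
  have h : ∀ b : F, f (kloostermanSum p ζ b) = kloostermanSum p ζ ((j : F) ^ 2 * b) := fun b => by
    have := map_ringKloostermanSum (p := p) f ζ b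
    rw [hf, ringKloostermanSum_pow hζ hj] at this
    exact this
  simp only [kloostermanCharpoly, Polynomial.map_prod, Polynomial.map_sub, map_X, map_C, h]
  rw [← prod_half_mul hp (fun b : F => X - C (kloostermanSum p ζ (b * a))) hj]
  refine Finset.prod_congr rfl fun i _ => ?_
  rw [Nat.cast_mul, mul_pow, mul_assoc]

theorem isIntegral_coeff_kloostermanCharpoly (hζ : IsPrimitiveRoot ζ p) (a : F) (n : ℕ) :
    IsIntegral ℤ ((kloostermanCharpoly p ζ a).coeff n) := by
  have hint : IsIntegral ℤ ζ := hζ.isIntegral (Fact.out : p.Prime).pos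
  let z : integralClosure ℤ K := ⟨ζ, hint⟩
  have h : kloostermanCharpoly p ζ a = (∏ i ∈ Finset.Icc 1 ((p - 1) / 2),
      (X - C (ringKloostermanSum p z ((i : F) ^ 2 * a)))).map
        (algebraMap (integralClosure ℤ K) K) := by
    simp only [Polynomial.map_prod, Polynomial.map_sub, map_X, Polynomial.map_C,
      map_ringKloostermanSum (algebraMap (integralClosure ℤ K) K)]
    rfl
  rw [h, coeff_map]
  exact (Subtype.property _)

variable [CharZero K] [IsCyclotomicExtension {p} ℚ K]

theorem exists_map_eq_kloostermanCharpoly (hp : p ≠ 2) (hζ : IsPrimitiveRoot ζ p) (a : F) :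
    ∃ c : ℤ[X], c.map (Int.castRingHom K) = kloostermanCharpoly p ζ a := by
  rw [← mem_lifts, lifts_iff_coeff_lifts]
  intro n
  have : IsGalois ℚ K := IsCyclotomicExtension.isGalois {p} ℚ K
  have : FiniteDimensional ℚ K := IsCyclotomicExtension.finiteDimensional {p} ℚ K
  have hpp : p.Prime := Fact.out
  have hfix : (kloostermanCharpoly p ζ a).coeff n ∈ Set.range (algebraMap ℚ K) := by
    rw [IsGalois.mem_range_algebraMap_iff_fixed]
    intro σ
    have hσ : IsPrimitiveRoot (σ ζ) p := hζ.map_of_injective σ.injective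
    obtain ⟨j, -, hcop, hj⟩ := (hζ.isPrimitiveRoot_iff).1 hσ
    have hj' : ¬p ∣ j := (hpp.coprime_iff_not_dvd).1 hcop.symm
    conv_rhs => rw [← map_kloostermanCharpoly hp hζ.pow_eq_one (σ : K →+* K) hj' hj.symm a]
    rw [coeff_map]
    rfl
  obtain ⟨r, hr⟩ := hfix
  have hint := isIntegral_coeff_kloostermanCharpoly hζ a n
  rw [← hr, isIntegral_algebraMap_iff (algebraMap ℚ K).injective,
    IsIntegrallyClosed.isIntegral_iff] at hint
  obtain ⟨m, rfl⟩ := hint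
  exact ⟨m, by simp [← hr]⟩

theorem aeval_minpoly_conjugate (hζ : IsPrimitiveRoot ζ p) (a : F) {i : ℕ} (hi : ¬p ∣ i) :
    aeval (kloostermanSum p ζ ((i : F) ^ 2 * a)) (minpoly ℚ (kloostermanSum p ζ a)) = 0 := by
  have hpp : p.Prime := Fact.out
  have hζi : IsPrimitiveRoot (ζ ^ i) p :=
    hζ.pow_of_coprime _ ((hpp.coprime_iff_not_dvd).2 hi).symm
  have hmin : minpoly ℚ (hζ.powerBasis ℚ).gen = minpoly ℚ (hζi.powerBasis ℚ).gen := by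
    rw [hζ.powerBasis_gen ℚ, hζi.powerBasis_gen ℚ, ← cyclotomic_eq_minpoly_rat hζ hpp.pos,
      ← cyclotomic_eq_minpoly_rat hζi hpp.pos]
  obtain ⟨σ, hσ⟩ : ∃ σ : K ≃ₐ[ℚ] K, σ ζ = ζ ^ i :=
    ⟨(hζ.powerBasis ℚ).equivOfMinpoly (hζi.powerBasis ℚ) hmin,
      (congrArg _ (hζ.powerBasis_gen ℚ).symm).trans
        (((hζ.powerBasis ℚ).equivOfMinpoly_gen (hζi.powerBasis ℚ) hmin).trans
          (hζi.powerBasis_gen ℚ))⟩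
  have hsum : kloostermanSum p ζ ((i : F) ^ 2 * a) = σ (kloostermanSum p ζ a) := by
    have := map_ringKloostermanSum (p := p) (σ : K →+* K) ζ a
    rw [RingHom.coe_coe, hσ, ringKloostermanSum_pow hζ.pow_eq_one hi] at this
    exact this.symm
  rw [hsum, aeval_algHom_apply, minpoly.aeval, map_zero]

/-- All roots of `c_a` are roots of the irreducible polynomial `m_a`, so `c_a` divides a power
of `m_a`. -/
theorem exists_eq_minpoly_pow (hζ : IsPrimitiveRoot ζ p) (a : F) {c : ℤ[X]}
    (hc : c.map (Int.castRingHom K) = kloostermanCharpoly p ζ a) :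
    ∃ e : ℕ, e ∣ (p - 1) / 2 ∧
      c.map (Int.castRingHom ℚ) = minpoly ℚ (kloostermanSum p ζ a) ^ e := by
  have hpp : p.Prime := Fact.out
  have : FiniteDimensional ℚ K := IsCyclotomicExtension.finiteDimensional {p} ℚ K
  have hint : IsIntegral ℚ (kloostermanSum p ζ a) := IsIntegral.of_finite ℚ _
  have hcK : (c.map (Int.castRingHom ℚ)).map (algebraMap ℚ K) = kloostermanCharpoly p ζ a := by
    rw [Polynomial.map_map, ← hc]
    congr 1
    exact RingHom.ext_int _ _
  have hdvd : c.map (Int.castRingHom ℚ) ∣ minpoly ℚ (kloostermanSum p ζ a) ^ ((p - 1) / 2) := by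
    rw [← map_dvd_map' (algebraMap ℚ K), hcK, Polynomial.map_pow]
    have hcard : (minpoly ℚ (kloostermanSum p ζ a)).map (algebraMap ℚ K) ^ ((p - 1) / 2) =
        ∏ _i ∈ Finset.Icc 1 ((p - 1) / 2),
          (minpoly ℚ (kloostermanSum p ζ a)).map (algebraMap ℚ K) := by simp
    rw [hcard]
    refine Finset.prod_dvd_prod_of_dvd _ _ fun i hi => ?_
    rw [dvd_iff_isRoot, IsRoot.def, eval_map_algebraMap]
    refine aeval_minpoly_conjugate hζ a fun hdiv => ?_
    have := Nat.le_of_dvd (by have := Finset.mem_Icc.1 hi; omega) hdiv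
    have := Finset.mem_Icc.1 hi
    omega
  obtain ⟨e, -, he⟩ := (dvd_prime_pow (minpoly.irreducible hint).prime _).1 hdvd
  have hmonic : (c.map (Int.castRingHom ℚ)).Monic := by
    rw [← monic_map_iff (f := algebraMap ℚ K), hcK]
    exact monic_kloostermanCharpoly a
  have heq := eq_of_monic_of_associated hmonic ((minpoly.monic hint).pow e) he
  refine ⟨e, ⟨(minpoly ℚ (kloostermanSum p ζ a)).natDegree, ?_⟩, heq⟩
  rw [← natDegree_pow, ← heq, ← natDegree_map (algebraMap ℚ K), hcK, natDegree_kloostermanCharpoly]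

/-- The product of the conjugates modulo `p²`, together with the weaker statement that also
holds for `q = 3`. -/
theorem intCast_eq_prod_congruence (hp : p ≠ 2) (hζ : IsPrimitiveRoot ζ p) (a : F) {m : ℤ}
    (hm : (m : K) = ∏ i ∈ Finset.Icc 1 ((p - 1) / 2), kloostermanSum p ζ ((i : F) ^ 2 * a)) :
    (p : ℤ) ∣ m ∧ (Fintype.card F ≠ 3 →
      m ≡ (p : ℤ) * legendreSym p ((Algebra.trace (ZMod p) F a).val : ℤ) [ZMOD (p : ℤ) ^ 2]) := by
  have hpp : p.Prime := Fact.out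
  have hu : ¬IsUnit (hζ.toInteger - 1) := hζ.zeta_sub_one_prime'.not_isUnit
  have hz := hζ.toInteger_isPrimitiveRoot
  have hprod : (m : NumberField.RingOfIntegers K) = ∏ i ∈ Finset.Icc 1 ((p - 1) / 2),
      ringKloostermanSum p hζ.toInteger ((i : F) ^ 2 * a) := by
    apply NumberField.RingOfIntegers.coe_injective
    rw [map_prod, map_intCast, hm]
    refine Finset.prod_congr rfl fun i _ => ?_
    rw [map_ringKloostermanSum]
    rfl
  refine ⟨prime_dvd_of_sub_one_dvd hp hz hu ?_, fun hq => ?_⟩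
  · rw [hprod]
    refine (sub_one_dvd_ringKloostermanSum hp hz _).trans (Finset.dvd_prod_of_mem _ (a := 1) ?_)
    have := hpp.two_le
    exact Finset.mem_Icc.2 ⟨le_rfl, by omega⟩
  · refine (Int.modEq_iff_dvd.2 (prime_sq_dvd_of_sub_one_pow_dvd hp hz hu ?_)).symm
    have := sub_one_pow_dvd_prod_sub_legendreSym hp hz hq a
    rw [← hprod] at this
    push_cast
    exact this

end Conjugates

/-- For `q = 3` the residue is not determined, but every multiple of `3` is `0` or `± 3` modulo
`9`. -/
theorem constantCoeff_congruence {p : ℕ} [Fact p.Prime] {F : Type*} [Fintype F] {m s : ℤ} {t : ℤ}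
    (hs : s = 1 ∨ s = -1) (hdvd : (p : ℤ) ∣ m)
    (hm : Fintype.card F ≠ 3 → m ≡ (p : ℤ) * legendreSym p t [ZMOD (p : ℤ) ^ 2])
    (hp3 : Fintype.card F = 3 → p = 3) :
    s * m ≡ 0 [ZMOD (p : ℤ) ^ 2] ∨ s * m ≡ (p : ℤ) [ZMOD (p : ℤ) ^ 2] ∨
      s * m ≡ -(p : ℤ) [ZMOD (p : ℤ) ^ 2] := by
  by_cases hq : Fintype.card F = 3
  · obtain rfl := hp3 hq
    simp only [Int.ModEq]
    rcases hs with rfl | rfl <;> omega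
  · have h := (hm hq).mul_left s
    by_cases ht : (t : ZMod p) = 0
    · left
      rwa [(legendreSym.eq_zero_iff p t).2 ht, mul_zero, mul_zero] at h
    · right
      rcases legendreSym.eq_one_or_neg_one p ht with h1 | h1 <;> rw [h1] at h <;>
        rcases hs with rfl | rfl
      · left; simpa using h
      · right; simpa using h
      · right; simpa using h
      · left; simpa using h

theorem theorem1 (p : ℕ) [Fact p.Prime] (hp : p ≠ 2)
    {F : Type*} [Field F] [Fintype F] [Algebra (ZMod p) F]
    {L : Type*} [Field L] [CharZero L] (ζ : L) (hζ : IsPrimitiveRoot ζ p) (a : F) :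
    -- the product of the conjugates is a rational integer `m`, and the congruence for it
    ∃ m : ℤ, (m : L) = ∏ i ∈ Finset.Icc 1 ((p - 1) / 2), kloostermanSum p ζ ((i : F) ^ 2 * a) ∧
      (Fintype.card F ≠ 3 →
        m ≡ (p : ℤ) * legendreSym p ((Algebra.trace (ZMod p) F a).val : ℤ) [ZMOD (p : ℤ) ^ 2]) ∧
      -- `c_a` has integer coefficients, is a power of the minimal polynomial of `K_q(a)` over `ℚ`,
      -- and its constant term is `0` or `± p` modulo `p²`
      ∃ c : ℤ[X], c.map (Int.castRingHom L) = kloostermanCharpoly p ζ a ∧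
        (∃ e : ℕ, e ∣ (p - 1) / 2 ∧
          c.map (Int.castRingHom ℚ) = minpoly ℚ (kloostermanSum p ζ a) ^ e) ∧
        c.coeff 0 = (-1) ^ ((p - 1) / 2) * m ∧
        (c.coeff 0 ≡ 0 [ZMOD (p : ℤ) ^ 2] ∨ c.coeff 0 ≡ (p : ℤ) [ZMOD (p : ℤ) ^ 2] ∨
          c.coeff 0 ≡ -(p : ℤ) [ZMOD (p : ℤ) ^ 2]) := by
  -- `L` need not be Galois or algebraic over `ℚ`, so the argument takes place in `ℚ(ζ) ⊆ L`.
  let K := IntermediateField.adjoin ℚ {ζ}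
  have hcyc : IsCyclotomicExtension {p} ℚ K :=
    (IntermediateField.isCyclotomicExtension_singleton_iff_eq_adjoin _ _ _ _ hζ).2 rfl
  let z : K := ⟨ζ, IntermediateField.mem_adjoin_simple_self ℚ ζ⟩
  have hz : IsPrimitiveRoot z p :=
    IsPrimitiveRoot.of_map_of_injective (f := algebraMap K L) hζ (algebraMap K L).injective
  have hsum : ∀ b : F, algebraMap K L (kloostermanSum p z b) = kloostermanSum p ζ b :=
    map_ringKloostermanSum (algebraMap K L) z
  have hsign : ((-1 : ℤ) ^ ((p - 1) / 2)) * (-1) ^ ((p - 1) / 2) = 1 := by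
    rw [← mul_pow]; simp
  obtain ⟨c, hc⟩ := exists_map_eq_kloostermanCharpoly hp hz a
  have hcoeff : (c.coeff 0 : K) = (-1) ^ ((p - 1) / 2) *
      ∏ i ∈ Finset.Icc 1 ((p - 1) / 2), kloostermanSum p z ((i : F) ^ 2 * a) := by
    rw [← coeff_zero_kloostermanCharpoly, ← hc, coeff_map, eq_intCast]
  have hm : (((-1) ^ ((p - 1) / 2) * c.coeff 0 : ℤ) : K) =
      ∏ i ∈ Finset.Icc 1 ((p - 1) / 2), kloostermanSum p z ((i : F) ^ 2 * a) := by
    have hsign' := congrArg (Int.cast : ℤ → K) hsign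
    push_cast at hsign' ⊢
    rw [hcoeff, ← mul_assoc, hsign', one_mul]
  have hconst : c.coeff 0 = (-1) ^ ((p - 1) / 2) * ((-1) ^ ((p - 1) / 2) * c.coeff 0) := by
    rw [← mul_assoc, hsign, one_mul]
  obtain ⟨hdvd, hcongr⟩ := intCast_eq_prod_congruence hp hz a hm
  refine ⟨(-1) ^ ((p - 1) / 2) * c.coeff 0, ?_, hcongr, c, ?_, ?_, hconst, ?_⟩
  · have := congrArg (algebraMap K L) hm
    simpa only [map_intCast, map_prod, hsum] using this
  · have := congrArg (Polynomial.map (algebraMap K L)) hc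
    rw [Polynomial.map_map, RingHom.ext_int ((algebraMap K L).comp _) (Int.castRingHom L)] at this
    rw [this]
    simp only [kloostermanCharpoly, Polynomial.map_prod, Polynomial.map_sub, map_X, map_C, hsum]
  · rw [← hsum, minpoly.algebraMap_eq (algebraMap K L).injective]
    exact exists_eq_minpoly_pow hz a hc
  · rw [hconst]
    refine constantCoeff_congruence (F := F) (neg_one_pow_eq_or ℤ _) hdvd hcongr fun hq => ?_
    rw [card_eq_prime_pow_finrank p] at hq
    exact (Nat.prime_dvd_prime_iff_eq Fact.out Nat.prime_three).1
      (hq ▸ dvd_pow_self p Module.finrank_pos.ne')
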